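/- **Notation.** Let $1\le m<n$ be integers such that $n/m$ is an integer. $W^{m,p}(\mathbb R^n)$ is the Sobolev space of real functions on $\mathbb R^n$ whose weak partial derivatives of order at most $m$ lie in $L^p(\mathbb R^n)$; $\|\cdot\|_p$ is the $L^p(\mathbb R^n)$ norm; and $\nabla^m u=\Delta^{m/2}u$ for even $m$, $\nabla^m u=\nabla\Delta^{(m-1)/2}u$ for odd $m$ (in the weak sense). Put $$\Phi(t)=e^t-\sum_{j=0}^{j_{m,n}-2}\frac{t^j}{j!},\qquad j_{m,n}=\min\{j\in\mathbb N: j\ge n/m\},$$ $$AD(n,m,\beta,\alpha,\gamma)=\sup_{\substack{u\in W^{m,n/m}(\mathbb R^n)\\ \|\nabla^m u\|_{n/m}^{n/m}+\|u\|_{n/m}^{n/m}\le 1}}\int_{\mathbb R^n}\Phi\left(\beta\left(\frac{1+\alpha\|u\|_{n/m}^{n/m}}{1-\gamma\alpha\|u\|_{n/m}^{n/m}}\right)^{\frac m{n-m}}|u|^{\frac n{n-m}}\right)dx\in[0,\infty].$$ With $\omega_{n-1}$ the surface area of the unit sphere of $\mathbb R^n$, let $$\beta_0=\frac n{\omega_{n-1}}\left[\frac{\pi^{n/2}2^m\,\Gamma(\frac{m+1}2)}{\Gamma(\frac{n-m+1}2)}\right]^{\frac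 n{n-m}}\ (m\text{ odd}),\qquad \beta_0=\frac n{\omega_{n-1}}\left[\frac{\pi^{n/2}2^m\,\Gamma(\frac m2)}{\Gamma(\frac{n-m}2)}\right]^{\frac n{n-m}}\ (m\text{ even}),$$ and let $\mathcal B_{GN}=\sup \|u\|_4^4/(\|\nabla^m u\|_2^2\|u\|_2^2)$, the supremum being over the nonzero radial $u\in W^{m,2}(\mathbb R^{2m})$. **Proposition.** Let $0<\alpha<1$ and $0\le\gamma<\frac1\alpha-1$. Then $$AD(n,m,\beta,\alpha,\gamma)>\frac{\beta^{\frac nm-1}}{(\frac nm-1)!}\left(\frac{1+\alpha}{1-\gamma\alpha}\right)$$ holds in each of the following cases: 1. $\frac nm\ge 3$ and $\beta\in(0,\beta_0]$; 2. $\frac nm=2$ and $\beta\in\left(\dfrac{1+2\alpha-\gamma\alpha^2}{1+\alpha(1-\gamma)-\gamma\alpha^2}\cdot\dfrac2{\mathcal B_{GN}},\ \beta_0\right]$ (in particular if in addition $\gamma<\frac{m(1+\alpha)-1-2\alpha}{m\alpha^2+\alpha m-\alpha^2}$). -/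

import Mathlib

open MeasureTheory
open scoped ENNReal ContDiff

noncomputable section

namespace AdamsAD

/-- `ℝⁿ` with its Euclidean norm and Lebesgue measure. -/
abbrev E (n : ℕ) : Type := EuclideanSpace ℝ (Fin n)

/-- `v` is the weak partial derivative `∂ᵢ u` on `ℝⁿ`: both functions are locally integrable and
`∫ u ∂ᵢφ = - ∫ v φ` for every `φ ∈ C_c^∞(ℝⁿ)`. -/
def HasWeakPartial {n : ℕ} (i : Fin n) (u v : E n → ℝ) : Prop :=
  LocallyIntegrable u volume ∧ LocallyIntegrable v volume ∧
    ∀ φ : E n → ℝ, ContDiff ℝ ∞ φ → HasCompactSupport φ →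
      ∫ x, u x * fderiv ℝ φ x (EuclideanSpace.single i 1) = - ∫ x, v x * φ x

/-- The Sobolev space `W^{m,p}(ℝⁿ)` (as a predicate on real functions): all the weak partial
derivatives of `u` of order at most `m` (`u` itself included) exist and lie in `Lᵖ(ℝⁿ)`. -/
def MemW {n : ℕ} : ℕ → ℝ≥0∞ → (E n → ℝ) → Prop
  | 0, p, u => MemLp u p volume
  | m + 1, p, u => MemLp u p volume ∧ ∀ i : Fin n, ∃ v, HasWeakPartial i u v ∧ MemW m p v

open Classical in
/-- A representative of the weak partial derivative `∂ᵢ u` (unique almost everywhere; the value is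
`0` when `u` has no weak derivative, which does not happen below the order of the Sobolev space). -/
def weakPartial {n : ℕ} (i : Fin n) (u : E n → ℝ) : E n → ℝ :=
  if h : ∃ v, HasWeakPartial i u v then h.choose else 0

/-- The weak Laplacian `Δ u = ∑ᵢ ∂ᵢ ∂ᵢ u`. -/
def weakLaplacian {n : ℕ} (u : E n → ℝ) : E n → ℝ :=
  fun x => ∑ i : Fin n, weakPartial i (weakPartial i u) x

/-- The pointwise Euclidean length `|∇^m u|` of the `m`-th order gradient, where
`∇^m u = Δ^{m/2} u` for even `m` and `∇^m u = ∇ Δ^{(m-1)/2} u` for odd `m`. -/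
def gradPowNorm {n : ℕ} (m : ℕ) (u : E n → ℝ) : E n → ℝ :=
  fun x =>
    if Even m then |weakLaplacian^[m / 2] u x|
    else ‖(WithLp.toLp 2 (fun i : Fin n => weakPartial i (weakLaplacian^[(m - 1) / 2] u) x) : E n)‖

/-- `‖f‖_p^p = ∫ |f|^p`, as an extended nonnegative number. -/
def lpPow {n : ℕ} (p : ℝ) (f : E n → ℝ) : ℝ≥0∞ :=
  ∫⁻ x, ENNReal.ofReal (|f x| ^ p)

/-- `Φ(t) = e^t - ∑_{j=0}^{j_{m,n}-2} t^j/j!`, where `j_{m,n} = ⌈n/m⌉` is the least natural number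
that is at least `n/m`. -/
def Phi (n m : ℕ) (t : ℝ) : ℝ :=
  Real.exp t - ∑ j ∈ Finset.range (⌈(n : ℝ) / m⌉₊ - 1), t ^ j / (Nat.factorial j : ℝ)

/-- The integral
`∫ Φ(β ((1 + α‖u‖^{n/m}_{n/m}) / (1 - γα‖u‖^{n/m}_{n/m}))^{m/(n-m)} |u|^{n/(n-m)}) dx`. -/
def functional (n m : ℕ) (β α γ : ℝ) (u : E n → ℝ) : ℝ≥0∞ :=
  ∫⁻ x, ENNReal.ofReal (Phi n m
    (β * ((1 + α * (lpPow ((n : ℝ) / m) u).toReal) /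
        (1 - γ * α * (lpPow ((n : ℝ) / m) u).toReal)) ^ ((m : ℝ) / ((n : ℝ) - m)) *
      |u x| ^ ((n : ℝ) / ((n : ℝ) - m))))

/-- `AD(n, m, β, α, γ)`: the supremum of the functional over all `u ∈ W^{m,n/m}(ℝⁿ)` with
`‖∇^m u‖^{n/m}_{n/m} + ‖u‖^{n/m}_{n/m} ≤ 1`. -/
def AD (n m : ℕ) (β α γ : ℝ) : ℝ≥0∞ :=
  ⨆ u ∈ {u : E n → ℝ | MemW m (ENNReal.ofReal ((n : ℝ) / m)) u ∧
      lpPow ((n : ℝ) / m) (gradPowNorm m u) + lpPow ((n : ℝ) / m) u ≤ 1},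
    functional n m β α γ u

/-- The surface measure `ω_{n-1}` of the unit sphere of `ℝⁿ`. -/
def sphereArea (n : ℕ) : ℝ := (volume : Measure (E n)).toSphere.real Set.univ

/-- The Adams critical constant `β₀(m, n)`. -/
def betaZero (n m : ℕ) : ℝ :=
  if Odd m then
    (n : ℝ) / sphereArea n *
      (Real.pi ^ ((n : ℝ) / 2) * 2 ^ m * Real.Gamma (((m : ℝ) + 1) / 2) /
        Real.Gamma (((n : ℝ) - m + 1) / 2)) ^ ((n : ℝ) / ((n : ℝ) - m))
  else
    (n : ℝ) / sphereArea n *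
      (Real.pi ^ ((n : ℝ) / 2) * 2 ^ m * Real.Gamma ((m : ℝ) / 2) /
        Real.Gamma (((n : ℝ) - m) / 2)) ^ ((n : ℝ) / ((n : ℝ) - m))

/-- `u` is radial: it agrees almost everywhere with a function of `|x|`. -/
def IsRadial {n : ℕ} (u : E n → ℝ) : Prop :=
  ∃ f : ℝ → ℝ, u =ᵐ[volume] fun x => f ‖x‖

/-- The Gagliardo–Nirenberg constant: the supremum of `‖u‖_4^4 / (‖∇^m u‖_2^2 ‖u‖_2^2)` over the
nonzero radial functions `u ∈ W^{m,2}(ℝ^{2m})`. -/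
def gagliardoNirenberg (m : ℕ) : ℝ≥0∞ :=
  ⨆ u ∈ {u : E (2 * m) → ℝ | MemW m 2 u ∧ IsRadial u ∧ ¬ u =ᵐ[volume] 0},
    lpPow 4 u / (lpPow 2 (gradPowNorm m u) * lpPow 2 u)

end AdamsAD

end

/-! Put `p = n / m`. The right-hand side is what the leading term of `Φ` would give if all the mass
sat in `‖u‖_p^p = 1`, so the supremum is tested on functions that nearly vanish in gradient
(vanishing sequences). Given `v` with `‖v‖_p^p = A` and `‖∇^m v‖_p^p = B`, dilate and normalise to
`w` with `‖∇^m w‖_p^p = a B` and `‖w‖_p^p = s = 1 - a B`, where `a` is small. As `n = p m`, the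
gradient energy is invariant under `x ↦ r x`, so both norms can be prescribed.

Keep only the terms of degree `p - 1` and `p` of `Φ`, and let `K(s) = (1 + α s) / (1 - γ α s)`. The
first is proportional to `K(s) s`, short of `K(1)` by a loss of order `a`; the second is a gain of
order `a ^ (1 / (p - 1))`. For `p ≥ 3` the gain wins with any nonzero test function. For `p = 2` the
orders agree, and the comparison of coefficients is a lower bound on the Gagliardo–Nirenberg
quotient of `v`; the assumption on `β` supplies such a `v`.

The argument rests on `gradPowNorm_dilate` and `lpPow_dilate` (scaling), `functional_ge` (two
terms), `exists_small_parameter` (loss against gain) and `lt_AD_of_memW`, which combines them. -/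

namespace AdamsAD

/-! ### Weak derivatives and `Lᵖ` norms under dilation. -/

/-- The dilation `x ↦ c u(r x)` of `u`. -/
def dilate {n : ℕ} (c r : ℝ) (u : E n → ℝ) : E n → ℝ := fun x => c * u (r • x)

lemma dilate_congr_ae {n : ℕ} (c : ℝ) {r : ℝ} (hr : r ≠ 0) {u v : E n → ℝ}
    (h : u =ᵐ[volume] v) : dilate c r u =ᵐ[volume] dilate c r v := by
  have := (Measure.quasiMeasurePreserving_smul (volume : Measure (E n)) hr).ae_eq_comp h
  filter_upwards [this] with x hx
  simp only [Function.comp_apply] at hx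
  simp [dilate, hx]

lemma dilate_dilate {n : ℕ} (c d r s : ℝ) (u : E n → ℝ) :
    dilate c r (dilate d s u) = dilate (c * d) (s * r) u := by
  funext x
  simp [dilate, smul_smul, mul_assoc]

lemma dilate_inv_dilate {n : ℕ} {c r : ℝ} (hc : c ≠ 0) (hr : r ≠ 0) (u : E n → ℝ) :
    dilate c⁻¹ r⁻¹ (dilate c r u) = u := by
  rw [dilate_dilate, inv_mul_cancel₀ hc, mul_inv_cancel₀ hr]
  funext x
  simp [dilate]

lemma LocallyIntegrable.dilate {n : ℕ} (c : ℝ) {r : ℝ} (hr : r ≠ 0) {u : E n → ℝ}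
    (hu : LocallyIntegrable u volume) : LocallyIntegrable (dilate c r u) volume := by
  have h1 : LocallyIntegrable u (Measure.map (Homeomorph.smulOfNeZero r hr : E n ≃ₜ E n)
      (volume : Measure (E n))) := by
    have : Measure.map (Homeomorph.smulOfNeZero r hr : E n ≃ₜ E n) (volume : Measure (E n)) = _ :=
      Measure.map_addHaar_smul (volume : Measure (E n)) hr
    rw [this]
    intro x
    obtain ⟨s, hs, hi⟩ := hu x
    refine ⟨s, hs, ?_⟩
    rw [IntegrableOn, Measure.restrict_smul]
    exact hi.smul_measure ENNReal.ofReal_ne_top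
  rw [locallyIntegrable_map_homeomorph] at h1
  exact h1.smul c

lemma HasWeakPartial.dilate {n : ℕ} {i : Fin n} {u v : E n → ℝ} (h : HasWeakPartial i u v)
    (c : ℝ) {r : ℝ} (hr : r ≠ 0) :
    HasWeakPartial i (dilate c r u) (dilate (c * r) r v) := by
  refine ⟨LocallyIntegrable.dilate c hr h.1, LocallyIntegrable.dilate _ hr h.2.1, ?_⟩
  intro φ hφ hφc
  set ψ : E n → ℝ := fun y => φ (r⁻¹ • y) with hψ
  have hψs : ContDiff ℝ ∞ ψ := hφ.comp (contDiff_const_smul _)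
  have hψc : HasCompactSupport ψ := hφc.comp_homeomorph (Homeomorph.smulOfNeZero r⁻¹ (inv_ne_zero hr))
  have hder : ∀ x, fderiv ℝ φ x (EuclideanSpace.single i 1)
      = r * fderiv ℝ ψ (r • x) (EuclideanSpace.single i 1) := by
    intro x
    have hψ' : HasFDerivAt ψ (r⁻¹ • fderiv ℝ φ x) (r • x) := by
      have h1 : HasFDerivAt φ (fderiv ℝ φ x) (r⁻¹ • (r • x)) := by
        rw [smul_smul, inv_mul_cancel₀ hr, one_smul]
        exact (hφ.differentiable (by simp) x).hasFDerivAt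
      have h2 : HasFDerivAt (fun y : E n => r⁻¹ • y)
          (r⁻¹ • ContinuousLinearMap.id ℝ (E n)) (r • x) :=
        (hasFDerivAt_id (r • x)).const_smul r⁻¹
      have := h1.comp (r • x) h2
      rwa [ContinuousLinearMap.comp_smul, ContinuousLinearMap.comp_id] at this
    rw [hψ'.fderiv]
    simp [mul_inv_cancel_left₀ hr]
  have key := h.2.2 ψ hψs hψc
  have e1 : ∫ x, AdamsAD.dilate c r u x * fderiv ℝ φ x (EuclideanSpace.single i 1)
      = ∫ x, (fun y => c * r * (u y * fderiv ℝ ψ y (EuclideanSpace.single i 1))) (r • x) := by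
    congr 1
    funext x
    rw [hder]
    simp only [AdamsAD.dilate]
    ring
  have e2 : ∫ x, AdamsAD.dilate (c * r) r v x * φ x
      = ∫ x, (fun y => c * r * (v y * ψ y)) (r • x) := by
    congr 1
    funext x
    simp only [AdamsAD.dilate, hψ, smul_smul, inv_mul_cancel₀ hr, one_smul]
    ring
  rw [e1, e2, Measure.integral_comp_smul volume
      (fun y => c * r * (u y * fderiv ℝ ψ y (EuclideanSpace.single i 1))) r,
    Measure.integral_comp_smul volume (fun y => c * r * (v y * ψ y)) r, integral_const_mul,
    integral_const_mul, key]
  simp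

lemma HasWeakPartial.congr_ae {n : ℕ} {i : Fin n} {u u' v v' : E n → ℝ}
    (h : HasWeakPartial i u v) (hu : u =ᵐ[volume] u') (hv : v =ᵐ[volume] v') :
    HasWeakPartial i u' v' := by
  refine ⟨h.1.congr hu, h.2.1.congr hv, fun φ hφ hφc => ?_⟩
  have e1 : ∫ x, u x * fderiv ℝ φ x (EuclideanSpace.single i 1)
      = ∫ x, u' x * fderiv ℝ φ x (EuclideanSpace.single i 1) :=
    integral_congr_ae (hu.mul (ae_eq_refl _))
  have e2 : ∫ x, v x * φ x = ∫ x, v' x * φ x := integral_congr_ae (hv.mul (ae_eq_refl _))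
  rw [← e1, ← e2]
  exact h.2.2 φ hφ hφc

lemma HasWeakPartial.unique {n : ℕ} {i : Fin n} {u v w : E n → ℝ} (hv : HasWeakPartial i u v)
    (hw : HasWeakPartial i u w) : v =ᵐ[volume] w := by
  refine ae_eq_of_integral_contDiff_smul_eq hv.2.1 hw.2.1 fun g hg hgc => ?_
  have := (hv.2.2 g hg hgc).symm.trans (hw.2.2 g hg hgc)
  simpa [mul_comm] using this

lemma HasWeakPartial.weakPartial_ae_eq {n : ℕ} {i : Fin n} {u v : E n → ℝ}
    (h : HasWeakPartial i u v) : weakPartial i u =ᵐ[volume] v := by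
  have hex : ∃ v, HasWeakPartial i u v := ⟨v, h⟩
  rw [weakPartial, dif_pos hex]
  exact hex.choose_spec.unique h

/-- A true equality, not just almost everywhere: the predicate `HasWeakPartial i u` depends only on
the class of `u`, so the same representative is chosen. This lets almost-everywhere identities pass
through iterated derivatives. -/
lemma weakPartial_congr_ae {n : ℕ} (i : Fin n) {u u' : E n → ℝ} (h : u =ᵐ[volume] u') :
    weakPartial i u = weakPartial i u' := by
  have : HasWeakPartial i u = HasWeakPartial i u' := by
    funext v
    exact propext ⟨fun H => H.congr_ae h (ae_eq_refl _), fun H => H.congr_ae h.symm (ae_eq_refl _)⟩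
  unfold weakPartial
  rw [this]

lemma weakLaplacian_congr_ae {n : ℕ} {u u' : E n → ℝ} (h : u =ᵐ[volume] u') :
    weakLaplacian u = weakLaplacian u' := by
  unfold weakLaplacian
  simp_rw [fun i => weakPartial_congr_ae i h]

lemma weakPartial_dilate {n : ℕ} (i : Fin n) {c r : ℝ} (hc : c ≠ 0) (hr : r ≠ 0)
    (u : E n → ℝ) :
    weakPartial i (dilate c r u) =ᵐ[volume] dilate (c * r) r (weakPartial i u) := by
  by_cases hex : ∃ v, HasWeakPartial i u v
  · obtain ⟨v, hv⟩ := hex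
    exact (hv.dilate c hr).weakPartial_ae_eq.trans
      (dilate_congr_ae _ hr hv.weakPartial_ae_eq).symm
  -- Dilations are invertible, so a weak derivative of the dilate would give one of `u`; both sides
  -- then take the default value `0`.
  · have hex' : ¬ ∃ v, HasWeakPartial i (dilate c r u) v := by
      rintro ⟨v, hv⟩
      have := hv.dilate c⁻¹ (inv_ne_zero hr)
      rw [dilate_inv_dilate hc hr] at this
      exact hex ⟨_, this⟩
    rw [weakPartial, dif_neg hex', weakPartial, dif_neg hex]
    exact Filter.Eventually.of_forall fun x => by simp [dilate]

lemma weakLaplacian_dilate {n : ℕ} {c r : ℝ} (hc : c ≠ 0) (hr : r ≠ 0) (u : E n → ℝ) :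
    weakLaplacian (dilate c r u) =ᵐ[volume] dilate (c * r ^ 2) r (weakLaplacian u) := by
  have h : ∀ i : Fin n, weakPartial i (weakPartial i (dilate c r u)) =ᵐ[volume]
      dilate (c * r ^ 2) r (weakPartial i (weakPartial i u)) := fun i => by
    rw [weakPartial_congr_ae i (weakPartial_dilate i hc hr u), pow_two, ← mul_assoc]
    exact weakPartial_dilate i (mul_ne_zero hc hr) hr _
  filter_upwards [ae_all_iff.2 h] with x hx
  simp only [weakLaplacian, hx, dilate, Finset.mul_sum]

lemma weakLaplacian_iterate_dilate {n : ℕ} {c r : ℝ} (hc : c ≠ 0) (hr : r ≠ 0) (k : ℕ)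
    (u : E n → ℝ) :
    weakLaplacian^[k] (dilate c r u) =ᵐ[volume]
      dilate (c * r ^ (2 * k)) r (weakLaplacian^[k] u) := by
  induction k with
  | zero => simp
  | succ k ih =>
    rw [Function.iterate_succ_apply', Function.iterate_succ_apply', weakLaplacian_congr_ae ih]
    refine (weakLaplacian_dilate (mul_ne_zero hc (pow_ne_zero _ hr)) hr _).trans ?_
    rw [show c * r ^ (2 * k) * r ^ 2 = c * r ^ (2 * (k + 1)) by ring]

lemma gradPowNorm_dilate {n : ℕ} (m : ℕ) {c r : ℝ} (hc : 0 < c) (hr : 0 < r) (u : E n → ℝ) :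
    gradPowNorm m (dilate c r u) =ᵐ[volume] dilate (c * r ^ m) r (gradPowNorm m u) := by
  rcases Nat.even_or_odd' m with ⟨k, rfl | rfl⟩
  · filter_upwards [weakLaplacian_iterate_dilate hc.ne' hr.ne' k u] with x hx
    simp [gradPowNorm, hx, dilate, abs_mul, abs_of_pos hc, abs_of_pos hr]
  · have h : ∀ i : Fin n, weakPartial i (weakLaplacian^[k] (dilate c r u)) =ᵐ[volume]
        dilate (c * r ^ (2 * k + 1)) r (weakPartial i (weakLaplacian^[k] u)) := fun i => by
      rw [weakPartial_congr_ae i (weakLaplacian_iterate_dilate hc.ne' hr.ne' k u), pow_succ,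
        ← mul_assoc]
      exact weakPartial_dilate i (mul_pos hc (pow_pos hr _)).ne' hr.ne' _
    filter_upwards [ae_all_iff.2 h] with x hx
    have hodd : ¬ Even (2 * k + 1) := by simp
    simp only [gradPowNorm, if_neg hodd, Nat.add_sub_cancel,
      Nat.mul_div_cancel_left k (show 0 < 2 by norm_num), hx, dilate]
    have hp : 0 < c * r ^ (2 * k + 1) := by positivity
    rw [← abs_of_pos hp, ← Real.norm_eq_abs, ← norm_smul]
    congr 1
    ext i
    simp [abs_of_pos hc, abs_of_pos hr]

lemma lpPow_congr_ae {n : ℕ} (p : ℝ) {f g : E n → ℝ} (h : f =ᵐ[volume] g) :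
    lpPow p f = lpPow p g := by
  refine lintegral_congr_ae ?_
  filter_upwards [h] with x hx
  rw [hx]

lemma lintegral_comp_smul {n : ℕ} {r : ℝ} (hr : 0 < r) (f : E n → ℝ≥0∞) :
    ∫⁻ x, f (r • x) = ENNReal.ofReal (r ^ n)⁻¹ * ∫⁻ x, f x := by
  have h1 := lintegral_map_equiv (μ := (volume : Measure (E n))) f
    (Homeomorph.smulOfNeZero r hr.ne' : E n ≃ₜ E n).toMeasurableEquiv
  have h2 : Measure.map (Homeomorph.smulOfNeZero r hr.ne' : E n ≃ₜ E n).toMeasurableEquiv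
      (volume : Measure (E n)) = ENNReal.ofReal |(r ^ Module.finrank ℝ (E n))⁻¹| • volume :=
    Measure.map_addHaar_smul (volume : Measure (E n)) hr.ne'
  rw [h2, lintegral_smul_measure, finrank_euclideanSpace_fin,
    abs_of_pos (inv_pos.2 (pow_pos hr n))] at h1
  exact h1.symm

lemma lpPow_dilate {n : ℕ} (p : ℝ) {c r : ℝ} (hc : 0 < c) (hr : 0 < r) (f : E n → ℝ) :
    lpPow p (dilate c r f) = ENNReal.ofReal (c ^ p * (r ^ n)⁻¹) * lpPow p f := by
  unfold lpPow dilate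
  have : ∀ x : E n, ENNReal.ofReal (|c * f (r • x)| ^ p)
      = (fun y => ENNReal.ofReal (c ^ p) * ENNReal.ofReal (|f y| ^ p)) (r • x) := fun x => by
    simp only
    rw [abs_mul, abs_of_pos hc, Real.mul_rpow hc.le (abs_nonneg _),
      ENNReal.ofReal_mul (Real.rpow_nonneg hc.le _)]
  simp_rw [this]
  rw [lintegral_comp_smul hr (fun y => ENNReal.ofReal (c ^ p) * ENNReal.ofReal (|f y| ^ p)),
    lintegral_const_mul' _ _ ENNReal.ofReal_ne_top, ENNReal.ofReal_mul (Real.rpow_nonneg hc.le _)]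
  ring

lemma MemLp.dilate {n : ℕ} {p : ℝ≥0∞} (c : ℝ) {r : ℝ} (hr : r ≠ 0) {u : E n → ℝ}
    (hu : MemLp u p volume) : MemLp (dilate c r u) p volume := by
  have h1 : MemLp u p (Measure.map (r • ·) (volume : Measure (E n))) := by
    rw [Measure.map_addHaar_smul _ hr]
    exact hu.smul_measure ENNReal.ofReal_ne_top
  exact (h1.comp_of_map (measurable_const_smul r).aemeasurable).const_mul c

lemma MemW.dilate {n : ℕ} {p : ℝ≥0∞} {r : ℝ} (hr : r ≠ 0) :
    ∀ {m : ℕ} {u : E n → ℝ} (c : ℝ), MemW m p u → MemW m p (dilate c r u)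
  | 0, _, c, h => MemLp.dilate c hr h
  | _ + 1, _, c, h => ⟨MemLp.dilate c hr h.1, fun i => by
      obtain ⟨v, hv, hm⟩ := h.2 i
      exact ⟨_, hv.dilate c hr, MemW.dilate hr _ hm⟩⟩

lemma MemW.memLp {n m : ℕ} {p : ℝ≥0∞} {u : E n → ℝ} (h : MemW m p u) : MemLp u p volume := by
  cases m with
  | zero => exact h
  | succ m => exact h.1

/-! ### Smooth compactly supported functions. -/

lemma hasWeakPartial_of_contDiff {n : ℕ} (i : Fin n) {u : E n → ℝ} (hu : ContDiff ℝ ∞ u) :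
    HasWeakPartial i u (fun x => fderiv ℝ u x (EuclideanSpace.single i 1)) := by
  have hd : Continuous (fun x => fderiv ℝ u x (EuclideanSpace.single i 1)) :=
    (hu.continuous_fderiv (by simp)).clm_apply continuous_const
  refine ⟨hu.continuous.locallyIntegrable, hd.locallyIntegrable, fun φ hφ hφc => ?_⟩
  have hd' : Continuous (fun x => fderiv ℝ φ x (EuclideanSpace.single i 1)) :=
    (hφ.continuous_fderiv (by simp)).clm_apply continuous_const
  refine integral_mul_fderiv_eq_neg_fderiv_mul_of_integrable ?_ ?_ ?_
    (fun x _ => hu.differentiable (by simp) x) (fun x _ => hφ.differentiable (by simp) x)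
  · exact (hd.mul hφ.continuous).integrable_of_hasCompactSupport hφc.mul_left
  · exact (hu.continuous.mul hd').integrable_of_hasCompactSupport
      (hφc.fderiv_apply ℝ _).mul_left
  · exact (hu.continuous.mul hφ.continuous).integrable_of_hasCompactSupport hφc.mul_left

/-- `u` agrees almost everywhere with a function in `C_c^∞`. -/
def IsTestFunction {n : ℕ} (u : E n → ℝ) : Prop :=
  ∃ φ : E n → ℝ, ContDiff ℝ ∞ φ ∧ HasCompactSupport φ ∧ u =ᵐ[volume] φ

lemma contDiff_fderiv_single {n : ℕ} (i : Fin n) {u : E n → ℝ} (hu : ContDiff ℝ ∞ u) :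
    ContDiff ℝ ∞ (fun x => fderiv ℝ u x (EuclideanSpace.single i 1)) :=
  (hu.fderiv_right (m := ∞) (by simp)).clm_apply contDiff_const

lemma memW_of_contDiff {n : ℕ} (p : ℝ≥0∞) :
    ∀ (m : ℕ) {u : E n → ℝ}, ContDiff ℝ ∞ u → HasCompactSupport u → MemW m p u
  | 0, _, hu, hc => hu.continuous.memLp_of_hasCompactSupport hc
  | m + 1, _, hu, hc => ⟨hu.continuous.memLp_of_hasCompactSupport hc, fun i =>
      ⟨_, hasWeakPartial_of_contDiff i hu, memW_of_contDiff p m (contDiff_fderiv_single i hu)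
        (hc.fderiv_apply ℝ _)⟩⟩

lemma IsTestFunction.weakPartial {n : ℕ} (i : Fin n) {u : E n → ℝ} (h : IsTestFunction u) :
    IsTestFunction (weakPartial i u) := by
  obtain ⟨φ, hφ, hc, hu⟩ := h
  refine ⟨_, contDiff_fderiv_single i hφ, hc.fderiv_apply ℝ _, ?_⟩
  rw [weakPartial_congr_ae i hu]
  exact (hasWeakPartial_of_contDiff i hφ).weakPartial_ae_eq

lemma IsTestFunction.sum {n : ℕ} {ι : Type*} (s : Finset ι) {f : ι → E n → ℝ}
    (h : ∀ i ∈ s, IsTestFunction (f i)) : IsTestFunction (fun x => ∑ i ∈ s, f i x) := by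
  classical
  induction s using Finset.induction_on with
  | empty => exact ⟨fun _ => 0, contDiff_const, HasCompactSupport.zero, by simp⟩
  | insert a s ha ih =>
    obtain ⟨φ, hφ, hc, hu⟩ := h a (Finset.mem_insert_self a s)
    obtain ⟨ψ, hψ, hc', hu'⟩ := ih fun i hi => h i (Finset.mem_insert_of_mem hi)
    refine ⟨φ + ψ, hφ.add hψ, hc.add hc', ?_⟩
    simp_rw [Finset.sum_insert ha]
    exact hu.add hu'

lemma IsTestFunction.weakLaplacian_iterate {n : ℕ} {u : E n → ℝ} (h : IsTestFunction u) (k : ℕ) :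
    IsTestFunction (weakLaplacian^[k] u) := by
  induction k with
  | zero => exact h
  | succ k ih =>
    rw [Function.iterate_succ_apply']
    exact IsTestFunction.sum _ fun i _ => (ih.weakPartial i).weakPartial i

lemma lpPow_lt_top {n : ℕ} {p : ℝ} (hp : 0 < p) {f : E n → ℝ}
    (hf : MemLp f (ENNReal.ofReal p) volume) : lpPow p f < ⊤ := by
  have := lintegral_rpow_enorm_lt_top_of_eLpNorm_lt_top (by simpa using hp)
    ENNReal.ofReal_ne_top hf.2
  rw [ENNReal.toReal_ofReal hp.le] at this
  refine lt_of_eq_of_lt (lintegral_congr fun x => ?_) this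
  rw [← ENNReal.ofReal_rpow_of_nonneg (abs_nonneg _) hp.le, Real.enorm_eq_ofReal_abs]

lemma IsTestFunction.memLp {n : ℕ} (p : ℝ≥0∞) {u : E n → ℝ} (h : IsTestFunction u) :
    MemLp u p volume := by
  obtain ⟨φ, hφ, hc, hu⟩ := h
  exact (memLp_congr_ae hu).2 (hφ.continuous.memLp_of_hasCompactSupport hc)

/-- Chosen weak derivatives of a test function are again test functions up to null sets, hence in
every `Lᵖ`; for odd `m` the Euclidean length is dominated by the sum of the components. -/
lemma IsTestFunction.lpPow_gradPowNorm_lt_top {n : ℕ} (m : ℕ) {p : ℝ} (hp : 0 < p)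
    {u : E n → ℝ} (h : IsTestFunction u) : lpPow p (gradPowNorm m u) < ⊤ := by
  refine lpPow_lt_top hp ?_
  by_cases hm : Even m
  · have : gradPowNorm m u = fun x => |weakLaplacian^[m / 2] u x| := by
      funext x; simp [gradPowNorm, hm]
    rw [this]
    exact ((h.weakLaplacian_iterate _).memLp _).abs
  · have : gradPowNorm m u = fun x => ‖(WithLp.toLp 2 (fun i : Fin n =>
        AdamsAD.weakPartial i (weakLaplacian^[(m - 1) / 2] u) x) : E n)‖ := by
      funext x; simp [gradPowNorm, hm]
    rw [this]
    have hi := fun i : Fin n => ((h.weakLaplacian_iterate ((m - 1) / 2)).weakPartial i).memLp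
      (ENNReal.ofReal p)
    have hsum := memLp_finsetSum Finset.univ fun i _ => (hi i).abs
    refine hsum.mono' ?_ (Filter.Eventually.of_forall fun x => ?_)
    · have hae : AEMeasurable (fun x => (fun i : Fin n =>
          AdamsAD.weakPartial i (weakLaplacian^[(m - 1) / 2] u) x)) volume :=
        aemeasurable_pi_lambda _ fun i => (hi i).1.aemeasurable
      exact (((WithLp.measurable_toLp 2 (Fin n → ℝ)).comp_aemeasurable hae).norm).aestronglyMeasurable
    · rw [norm_norm]
      have hd : (WithLp.toLp 2 (fun i : Fin n =>
          AdamsAD.weakPartial i (weakLaplacian^[(m - 1) / 2] u) x) : E n) =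
          ∑ i : Fin n, EuclideanSpace.single i
            (AdamsAD.weakPartial i (weakLaplacian^[(m - 1) / 2] u) x) := by
        ext j
        simp [Finset.sum_apply, Pi.single_apply]
      rw [hd]
      exact (norm_sum_le _ _).trans_eq (Finset.sum_congr rfl fun i _ => by simp)

end AdamsAD

/-! ### The two-term lower bound and the scaling argument. -/

namespace AdamsAD

/-- Since `n / m = p` is an integer, `Phi` removes exactly the degrees `0, …, p - 2` from the
exponential series, and for `X ≥ 0` the tail can be cut after degree `p`. -/
lemma Phi_ge {m p : ℕ} (hm : 1 ≤ m) (hp : 2 ≤ p) {X : ℝ} (hX : 0 ≤ X) :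
    X ^ (p - 1) / (Nat.factorial (p - 1) : ℝ) + X ^ p / (Nat.factorial p : ℝ)
      ≤ Phi (p * m) m X := by
  have hm' : (m : ℝ) ≠ 0 := by positivity
  have h1 : ((p * m : ℕ) : ℝ) / m = p := by push_cast; field_simp
  have h2 := Real.sum_le_exp_of_nonneg hX (p + 1)
  rw [Finset.sum_range_succ] at h2
  obtain ⟨k, rfl⟩ : ∃ k, p = k + 1 := ⟨p - 1, by omega⟩
  rw [Finset.sum_range_succ] at h2
  rw [Phi, h1, Nat.ceil_natCast, Nat.add_sub_cancel]
  linarith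

lemma lpPow_ne_zero {n : ℕ} (q : ℝ) {u : E n → ℝ}
    (hu : AEStronglyMeasurable u volume) (h0 : ¬ u =ᵐ[volume] 0) : lpPow q u ≠ 0 := by
  intro h
  rw [lpPow, lintegral_eq_zero_iff' ((hu.aemeasurable.abs.pow_const q).ennreal_ofReal)] at h
  refine h0 ?_
  filter_upwards [h] with x hx
  by_contra hne
  have h1 : 0 < |u x| ^ q := Real.rpow_pos_of_pos (abs_pos.2 hne) q
  exact (ENNReal.ofReal_pos.2 h1).ne' hx

/-- The first two terms of the expansion of the functional bound it from below. -/
lemma functional_ge {m p : ℕ} (hm : 1 ≤ m) (hp : 2 ≤ p) {α β γ K : ℝ} (hβ : 0 < β) (hK : 0 < K)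
    {w : E (p * m) → ℝ} (hw : AEStronglyMeasurable w volume)
    (hKw : (1 + α * (lpPow p w).toReal) / (1 - γ * α * (lpPow p w).toReal) = K) :
    ENNReal.ofReal (β ^ (p - 1) / (Nat.factorial (p - 1) : ℝ) * K) * lpPow p w +
      ENNReal.ofReal (β ^ p / (Nat.factorial p : ℝ) * K ^ ((p : ℝ) / (p - 1))) *
        lpPow (p * ((p : ℝ) / (p - 1))) w ≤ functional (p * m) m β α γ w := by
  have hm' : (m : ℝ) ≠ 0 := by positivity
  have hp' : (2 : ℝ) ≤ p := by exact_mod_cast hp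
  have hp1 : (p : ℝ) - 1 ≠ 0 := by linarith
  have h1 : ((p * m : ℕ) : ℝ) / m = p := by push_cast; field_simp
  have h2 : ((p * m : ℕ) : ℝ) - m = (p - 1) * m := by push_cast; ring
  have h3 : (m : ℝ) / ((p - 1) * m) = 1 / (p - 1) := by field_simp
  have h4 : ((p * m : ℕ) : ℝ) / ((p - 1) * m) = p / (p - 1) := by push_cast; field_simp
  have hcast : ((p - 1 : ℕ) : ℝ) = p - 1 := by rw [Nat.cast_sub (by omega)]; simp
  rw [functional, h1, h2, h3, h4, hKw, lpPow, lpPow,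
    ← lintegral_const_mul' _ _ ENNReal.ofReal_ne_top,
    ← lintegral_const_mul' _ _ ENNReal.ofReal_ne_top,
    ← lintegral_add_left' ((hw.aemeasurable.abs.pow_const _).ennreal_ofReal.const_mul _)]
  refine lintegral_mono fun x => ?_
  have hx := abs_nonneg (w x)
  have hX : 0 ≤ β * K ^ (1 / ((p : ℝ) - 1)) * |w x| ^ ((p : ℝ) / (p - 1)) := by positivity
  rw [← ENNReal.ofReal_mul (by positivity), ← ENNReal.ofReal_mul (by positivity),
    ← ENNReal.ofReal_add (by positivity) (by positivity)]
  refine ENNReal.ofReal_le_ofReal (le_trans (le_of_eq ?_) (Phi_ge hm hp hX))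
  -- The exponents `m / (n - m) = 1 / (p - 1)` and `n / (n - m) = p / (p - 1)` make the power `p -
  -- 1` produce exactly `K |w|^p`.
  have e1 : (K ^ (1 / ((p : ℝ) - 1))) ^ (p - 1) = K := by
    rw [← Real.rpow_mul_natCast hK.le, hcast, one_div_mul_cancel hp1, Real.rpow_one]
  have e2 : (K ^ (1 / ((p : ℝ) - 1))) ^ p = K ^ ((p : ℝ) / (p - 1)) := by
    rw [← Real.rpow_mul_natCast hK.le, one_div_mul_eq_div]
  have e3 : (|w x| ^ ((p : ℝ) / (p - 1))) ^ (p - 1) = |w x| ^ (p : ℝ) := by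
    rw [← Real.rpow_mul_natCast hx, hcast, div_mul_cancel₀ _ hp1]
  have e4 : (|w x| ^ ((p : ℝ) / (p - 1))) ^ p = |w x| ^ (p * ((p : ℝ) / (p - 1))) := by
    rw [← Real.rpow_mul_natCast hx, mul_comm]
  rw [mul_pow, mul_pow, mul_pow, mul_pow, e1, e2, e3, e4]
  ring

/-- The scalar inequality behind the lower bound: at mass `s = 1 - aB` the gain of order
`a^{1/(P-1)}` beats the loss of order `a`, provided it does so in the limit `a → 0`. -/
lemma exists_small_parameter {α γ P c₁ c₂ A B L : ℝ} (hα0 : 0 < α)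
    (hγα : γ * α < 1) (hP : 2 ≤ P) (hA : 0 < A)
    (hlim : c₁ * ((1 + α + (1 - γ * α) * α) / ((1 - γ * α) * (1 - γ * α))) * B *
        0 ^ ((P - 2) / (P - 1)) <
      c₂ * ((1 + α) / (1 - γ * α)) ^ (P / (P - 1)) * (L / A)) :
    ∃ a : ℝ, 0 < a ∧ 0 < 1 - a * B ∧
      c₁ * ((1 + α) / (1 - γ * α)) <
        c₁ * ((1 + α * (1 - a * B)) / (1 - γ * α * (1 - a * B))) * (1 - a * B) +
        c₂ * ((1 + α * (1 - a * B)) / (1 - γ * α * (1 - a * B))) ^ (P / (P - 1)) *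
          (a ^ (P / (P - 1)) * ((1 - a * B) / (a * A)) * L) := by
  have hP1 : 0 < P - 1 := by linarith
  have hden : 1 - γ * α * (1 - 0 * B) ≠ 0 := by
    have : 0 < 1 - γ * α * (1 - 0 * B) := by linarith
    exact this.ne'
  have hK0 : (1 + α * (1 - 0 * B)) / (1 - γ * α * (1 - 0 * B)) ≠ 0 := by
    refine div_ne_zero ?_ hden
    have : 0 < 1 + α * (1 - 0 * B) := by linarith
    exact this.ne'
  have hden2 : (1 - γ * α) * (1 - γ * α * (1 - 0 * B)) ≠ 0 :=
    mul_ne_zero (by linarith) hden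
  -- `F a` is gain minus loss, divided by `a ^ (1 / (P - 1))`. It is continuous at `0`, and `hlim`
  -- says `F 0 > 0`; there `0 ^ ((P - 2) / (P - 1))` is `1` for `P = 2` and `0` for `P > 2`, which
  -- treats both regimes at once.
  set F : ℝ → ℝ := fun a =>
    c₂ * ((1 + α * (1 - a * B)) / (1 - γ * α * (1 - a * B))) ^ (P / (P - 1)) *
        ((1 - a * B) * (L / A)) -
      c₁ * ((1 + α + (1 - γ * α) * α * (1 - a * B)) /
        ((1 - γ * α) * (1 - γ * α * (1 - a * B)))) * B * a ^ ((P - 2) / (P - 1)) with hF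
  have hlin : ContinuousAt (fun a : ℝ => 1 - a * B) 0 := by fun_prop
  have hrp : ContinuousAt (fun a : ℝ => a ^ ((P - 2) / (P - 1))) 0 :=
    Real.continuousAt_rpow_const _ _ (Or.inr (div_nonneg (by linarith) hP1.le))
  have hcont : ContinuousAt F 0 := by
    refine ContinuousAt.sub ?_ ?_
    · refine ContinuousAt.mul (continuousAt_const.mul ?_) (hlin.mul continuousAt_const)
      refine ContinuousAt.rpow_const ?_ (Or.inl hK0)
      exact ContinuousAt.div (by fun_prop) (by fun_prop) hden
    · refine ContinuousAt.mul ((continuousAt_const.mul ?_).mul continuousAt_const) hrp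
      exact ContinuousAt.div (by fun_prop) (by fun_prop) hden2
  have hF0 : 0 < F 0 := by
    simp only [hF, zero_mul, sub_zero, mul_one, one_mul]
    linarith
  have ev1 := hcont.eventually_const_lt hF0
  have ev2 : ∀ᶠ a in nhds (0 : ℝ), 0 < 1 - a * B :=
    hlin.eventually_const_lt (by simp)
  have ev3 : ∀ᶠ a in nhds (0 : ℝ), 0 < 1 - γ * α * (1 - a * B) := by
    have hc : ContinuousAt (fun a : ℝ => 1 - γ * α * (1 - a * B)) 0 := by fun_prop
    exact hc.eventually_const_lt (by simpa using hγα)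
  obtain ⟨a, ha, hFa, hs, hd⟩ := ((eventually_mem_nhdsWithin (a := (0 : ℝ)) (s := Set.Ioi 0)).and
    (((ev1.and (ev2.and ev3)).filter_mono nhdsWithin_le_nhds))).exists
  have ha' : 0 < a := ha
  refine ⟨a, ha', hs, ?_⟩
  have hd1 : 1 - γ * α ≠ 0 := by linarith
  have hB : a * B = 1 - (1 - a * B) := by ring
  have epow1 : a ^ (P / (P - 1)) = a ^ (1 / (P - 1)) * a := by
    rw [← Real.rpow_add_one ha'.ne']
    congr 1
    field_simp
    ring
  have epow2 : a = a ^ (1 / (P - 1)) * a ^ ((P - 2) / (P - 1)) := by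
    rw [← Real.rpow_add ha']
    conv_lhs => rw [← Real.rpow_one a]
    congr 1
    field_simp
    ring
  -- The numerator of `K(1) - K(s) s` vanishes at `s = 1`, whence the factor `1 - s = a B`.
  have hloss : (1 + α) / (1 - γ * α) -
      (1 + α * (1 - a * B)) / (1 - γ * α * (1 - a * B)) * (1 - a * B) =
      a * B * ((1 + α + (1 - γ * α) * α * (1 - a * B)) /
        ((1 - γ * α) * (1 - γ * α * (1 - a * B)))) := by
    have hd' := hd.ne'
    generalize hs' : 1 - a * B = s at *
    rw [hB, div_mul_eq_mul_div, div_sub_div _ _ hd1 hd', mul_div_assoc']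
    congr 1
    ring
  have hgain : a ^ (P / (P - 1)) * ((1 - a * B) / (a * A)) * L =
      a ^ (1 / (P - 1)) * ((1 - a * B) * (L / A)) := by
    rw [epow1]
    field_simp
  have hpos := mul_pos (Real.rpow_pos_of_pos ha' (1 / (P - 1))) hFa
  rw [hgain, ← sub_pos]
  refine hpos.trans_eq ?_
  have hloss' : c₁ * ((1 + α * (1 - a * B)) / (1 - γ * α * (1 - a * B))) * (1 - a * B) -
      c₁ * ((1 + α) / (1 - γ * α)) = - (c₁ * (a ^ (1 / (P - 1)) * a ^ ((P - 2) / (P - 1)) * B *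
        ((1 + α + (1 - γ * α) * α * (1 - a * B)) /
        ((1 - γ * α) * (1 - γ * α * (1 - a * B)))))) := by
    rw [← epow2, ← hloss]
    ring
  rw [add_sub_right_comm, hloss', hF]
  ring

/-- A single function `v ∈ W^{m,p}` whose norms satisfy a scale-invariant inequality yields, after
dilation and normalisation, the strict lower bound for `AD`. -/
lemma lt_AD_of_memW {m p : ℕ} (hm : 1 ≤ m) (hp : 2 ≤ p) {α β γ A B L : ℝ} (hα0 : 0 < α)
    (hγ0 : 0 ≤ γ) (hγα : γ * α < 1) (hβ : 0 < β) (hA : 0 < A) (hB : 0 ≤ B) (hL : 0 ≤ L)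
    {v : E (p * m) → ℝ} (hv : MemW m (ENNReal.ofReal p) v)
    (hvA : lpPow p v = ENNReal.ofReal A) (hvB : lpPow p (gradPowNorm m v) = ENNReal.ofReal B)
    (hvL : ENNReal.ofReal L ≤ lpPow (p * ((p : ℝ) / (p - 1))) v)
    (hlim : β ^ (p - 1) / (Nat.factorial (p - 1) : ℝ) *
        ((1 + α + (1 - γ * α) * α) / ((1 - γ * α) * (1 - γ * α))) * B *
        0 ^ (((p : ℝ) - 2) / (p - 1)) <
      β ^ p / (Nat.factorial p : ℝ) * ((1 + α) / (1 - γ * α)) ^ ((p : ℝ) / (p - 1)) * (L / A)) :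
    ENNReal.ofReal (β ^ (p - 1) / (Nat.factorial (p - 1) : ℝ) * ((1 + α) / (1 - γ * α)))
      < AD (p * m) m β α γ := by
  have hp' : (2 : ℝ) ≤ p := by exact_mod_cast hp
  have hp0 : (p : ℝ) ≠ 0 := by linarith
  have hm' : (m : ℝ) ≠ 0 := by positivity
  have hpm : p * m ≠ 0 := Nat.mul_ne_zero (by omega) (by omega)
  have h1 : ((p * m : ℕ) : ℝ) / m = p := by push_cast; field_simp
  obtain ⟨a, ha, hs, hlt⟩ := exists_small_parameter hα0 hγα hp' hA hlim
  set s := 1 - a * B with hsdef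
  have hs1 : s ≤ 1 := by have := mul_nonneg ha.le hB; linarith
  -- With `c ^ p = a` and `r ^ (-n) = N`, the dilate has mass `a N A = s` and gradient energy `a r ^
  -- (m p) N B = a B`, so the constraint is saturated.
  set N := s / (a * A) with hN
  have hNpos : 0 < N := by positivity
  set r := N⁻¹ ^ ((p * m : ℕ) : ℝ)⁻¹ with hr
  have hrpos : 0 < r := Real.rpow_pos_of_pos (inv_pos.2 hNpos) _
  have hrn : (r ^ (p * m))⁻¹ = N := by
    rw [hr, Real.rpow_inv_natCast_pow (inv_pos.2 hNpos).le hpm, inv_inv]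
  set c := a ^ (p : ℝ)⁻¹ with hc
  have hcpos : 0 < c := Real.rpow_pos_of_pos ha _
  have hcp : c ^ (p : ℝ) = a := by rw [hc, Real.rpow_inv_rpow ha.le hp0]
  set w := dilate c r v with hw
  have hwA : lpPow p w = ENNReal.ofReal s := by
    rw [hw, lpPow_dilate _ hcpos hrpos, hvA, ← ENNReal.ofReal_mul (by positivity), hcp, hrn, hN]
    congr 1
    field_simp
  have hwB : lpPow p (gradPowNorm m w) = ENNReal.ofReal (a * B) := by
    rw [hw, lpPow_congr_ae _ (gradPowNorm_dilate m hcpos hrpos v),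
      lpPow_dilate _ (by positivity) hrpos, hvB, ← ENNReal.ofReal_mul (by positivity),
      Real.mul_rpow hcpos.le (by positivity), hcp, Real.rpow_natCast, ← pow_mul, mul_comm m p]
    congr 1
    have : r ^ (p * m) ≠ 0 := by positivity
    field_simp
  have hwL : ENNReal.ofReal (a ^ ((p : ℝ) / (p - 1)) * N * L) ≤
      lpPow (p * ((p : ℝ) / (p - 1))) w := by
    rw [hw, lpPow_dilate _ hcpos hrpos, hrn, Real.rpow_mul hcpos.le, hcp,
      ENNReal.ofReal_mul (by positivity)]
    gcongr
  have hwmem : MemW m (ENNReal.ofReal p) w := hv.dilate hrpos.ne' c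
  have hγs : 0 < 1 - γ * α * s := by
    have : γ * α * s ≤ γ * α := mul_le_of_le_one_right (by positivity) hs1
    linarith
  have hK : 0 < (1 + α * s) / (1 - γ * α * s) := by positivity
  have hfun := functional_ge (α := α) (γ := γ) hm hp hβ hK hwmem.memLp.1
    (by rw [hwA, ENNReal.toReal_ofReal hs.le])
  have hAD : functional (p * m) m β α γ w ≤ AD (p * m) m β α γ := by
    refine le_iSup₂_of_le w ?_ le_rfl
    rw [Set.mem_ofPred_eq, h1]
    refine ⟨hwmem, ?_⟩
    rw [hwA, hwB, ← ENNReal.ofReal_add (by positivity) hs.le]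
    simp [hsdef]
  refine lt_of_lt_of_le ?_ (hfun.trans hAD)
  rw [hwA]
  refine lt_of_lt_of_le ?_ (add_le_add le_rfl (mul_le_mul_right hwL _))
  rw [← ENNReal.ofReal_mul (by positivity), ← ENNReal.ofReal_mul (by positivity),
    ← ENNReal.ofReal_add (by positivity) (by positivity)]
  exact (ENNReal.ofReal_lt_ofReal_iff_of_nonneg (by
    have : 0 < 1 - γ * α := by linarith
    positivity)).2 hlt

/-! ### The cases `n / m ≥ 3` and `n / m = 2`. -/

lemma lt_AD_of_three_le {m p : ℕ} (hm : 1 ≤ m) (hp : 3 ≤ p) {α β γ : ℝ} (hα0 : 0 < α)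
    (hγ0 : 0 ≤ γ) (hγα : γ * α < 1) (hβ : 0 < β) :
    ENNReal.ofReal (β ^ (p - 1) / (Nat.factorial (p - 1) : ℝ) * ((1 + α) / (1 - γ * α)))
      < AD (p * m) m β α γ := by
  have hp' : (3 : ℝ) ≤ p := by exact_mod_cast hp
  have hp0 : (0 : ℝ) < p := by linarith
  have hp1 : (0 : ℝ) < p - 1 := by linarith
  have hq : (0 : ℝ) < p * ((p : ℝ) / (p - 1)) := by positivity
  let b : ContDiffBump (0 : E (p * m)) := ⟨1, 2, one_pos, one_lt_two⟩
  set v : E (p * m) → ℝ := fun x => b x with hv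
  have hvs : ContDiff ℝ ∞ v := b.contDiff
  have hvc : HasCompactSupport v := b.hasCompactSupport
  have hmem := fun q : ℝ≥0∞ => hvs.continuous.memLp_of_hasCompactSupport (p := q) (μ := volume) hvc
  have hv0 : ¬ v =ᵐ[volume] 0 := by
    intro h
    have h0 : v = 0 := (hvs.continuous.ae_eq_iff_eq volume continuous_const).1 h
    have h1 : v 0 = 1 := b.one_of_mem_closedBall (by simp [b])
    rw [h0] at h1
    simp at h1
  have hA0 := lpPow_ne_zero p (hmem p).1 hv0
  have hAt := (lpPow_lt_top hp0 (hmem _)).ne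
  have hL0 := lpPow_ne_zero (p * ((p : ℝ) / (p - 1))) (hmem p).1 hv0
  have hLt := (lpPow_lt_top hq (hmem _)).ne
  have hBt := (IsTestFunction.lpPow_gradPowNorm_lt_top m hp0 ⟨v, hvs, hvc, ae_eq_refl _⟩).ne
  have hApos := ENNReal.toReal_pos hA0 hAt
  have hLpos := ENNReal.toReal_pos hL0 hLt
  refine lt_AD_of_memW hm (by omega) hα0 hγ0 hγα hβ hApos ENNReal.toReal_nonneg hLpos.le
    (memW_of_contDiff _ m hvs hvc) (ENNReal.ofReal_toReal hAt).symm
    (ENNReal.ofReal_toReal hBt).symm (ENNReal.ofReal_toReal hLt).le ?_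
  -- The exponent `(p - 2) / (p - 1)` is positive, so the loss disappears in the limit and only
  -- positivity of the gain is needed.
  rw [Real.zero_rpow (div_pos (by linarith) hp1).ne', mul_zero]
  have : 0 < 1 - γ * α := by linarith
  positivity

/-- The hypothesis rearranges to `2 k / β < B_GN`, with `k` the fraction in `h`; a radial function
whose quotient exceeds `2 k / β` serves as `v`, and its radiality plays no further role. -/
lemma lt_AD_of_two {m : ℕ} (hm : 1 ≤ m) {α β γ : ℝ} (hα0 : 0 < α)
    (hγ0 : 0 ≤ γ) (hγα : γ * α < 1)
    (h : ENNReal.ofReal ((1 + 2 * α - γ * α ^ 2) / (1 + α * (1 - γ) - γ * α ^ 2)) *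
      (2 / gagliardoNirenberg m) < ENNReal.ofReal β) :
    ENNReal.ofReal (β ^ (2 - 1) / (Nat.factorial (2 - 1) : ℝ) * ((1 + α) / (1 - γ * α)))
      < AD (2 * m) m β α γ := by
  have hβ : 0 < β := ENNReal.ofReal_pos.1 (bot_le.trans_lt h)
  have hg : 0 < 1 - γ * α := by linarith
  have hden : 1 + α * (1 - γ) - γ * α ^ 2 = (1 + α) * (1 - γ * α) := by ring
  have hnum : 1 + 2 * α - γ * α ^ 2 = 1 + α + (1 - γ * α) * α := by ring
  rw [hden, hnum] at h
  set k := (1 + α + (1 - γ * α) * α) / ((1 + α) * (1 - γ * α)) with hk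
  have hkpos : 0 < k := by positivity
  have hk2 : ENNReal.ofReal k * 2 = ENNReal.ofReal (k * 2) := by
    rw [ENNReal.ofReal_mul hkpos.le]; simp
  have hk2pos : ENNReal.ofReal (k * 2) ≠ 0 := (ENNReal.ofReal_pos.2 (by positivity)).ne'
  have hβ' : ENNReal.ofReal β ≠ 0 := (ENNReal.ofReal_pos.2 hβ).ne'
  rw [← mul_div_assoc, hk2, ENNReal.div_lt_iff (Or.inr hk2pos) (Or.inr ENNReal.ofReal_ne_top),
    mul_comm (ENNReal.ofReal β), ← ENNReal.div_lt_iff (Or.inl hβ') (Or.inl ENNReal.ofReal_ne_top),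
    ← ENNReal.ofReal_div_of_pos hβ, gagliardoNirenberg, lt_iSup_iff] at h
  obtain ⟨v, h⟩ := h
  rw [lt_iSup_iff] at h
  obtain ⟨⟨hv, -, hv0⟩, h⟩ := h
  have hv' : MemW m (ENNReal.ofReal (2 : ℕ)) v := by simpa using hv
  have h2 : (2 : ℝ) = (2 : ℕ) := by norm_num
  have h4 : (4 : ℝ) = (2 : ℕ) * (((2 : ℕ) : ℝ) / ((2 : ℕ) - 1)) := by norm_num
  have hA0 := lpPow_ne_zero 2 hv.memLp.1 hv0
  have hAt := (lpPow_lt_top (p := 2) two_pos (by simpa using hv.memLp)).ne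
  -- An infinite gradient norm would make the quotient `0`, which exceeds nothing.
  have hBt : lpPow 2 (gradPowNorm m v) ≠ ⊤ := by
    intro ht
    rw [ht, ENNReal.top_mul hA0, ENNReal.div_top] at h
    exact not_lt_bot h
  rw [ENNReal.lt_div_iff_mul_lt (Or.inr ENNReal.ofReal_ne_top)
    (Or.inl (ENNReal.mul_ne_top hBt hAt))] at h
  set A := (lpPow 2 v).toReal with hA
  set B := (lpPow 2 (gradPowNorm m v)).toReal with hB
  have hApos : 0 < A := ENNReal.toReal_pos hA0 hAt
  have hBnn : 0 ≤ B := ENNReal.toReal_nonneg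
  -- A real `L` strictly in between avoids having to know that `‖v‖_4` is finite.
  rw [← ENNReal.ofReal_toReal hAt, ← ENNReal.ofReal_toReal hBt, ← ENNReal.ofReal_mul hBnn,
    ← ENNReal.ofReal_mul (by positivity), ENNReal.lt_iff_exists_real_btwn] at h
  obtain ⟨L, hL0, hL1, hL2⟩ := h
  rw [ENNReal.ofReal_lt_ofReal_iff_of_nonneg (by positivity)] at hL1
  refine lt_AD_of_memW hm le_rfl hα0 hγ0 hγα hβ hApos hBnn hL0 hv'
    (by rw [← h2]; exact (ENNReal.ofReal_toReal hAt).symm)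
    (by rw [← h2]; exact (ENNReal.ofReal_toReal hBt).symm) (by rw [← h4]; exact hL2.le) ?_
  have e1 : (((2 : ℕ) : ℝ) - 2) / ((2 : ℕ) - 1) = 0 := by norm_num
  have e2 : ((2 : ℕ) : ℝ) / ((2 : ℕ) - 1) = (2 : ℕ) := by norm_num
  rw [e1, e2, Real.rpow_zero, Real.rpow_natCast]
  simp only [Nat.reduceSub, pow_one, Nat.factorial_one, Nat.factorial_two, Nat.cast_one, div_one,
    mul_one, Nat.cast_ofNat]
  have hLA : k * 2 / β * B < L / A := by
    rw [lt_div_iff₀ hApos]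
    linarith
  have hK1 : 1 ≤ (1 + α) / (1 - γ * α) := by
    rw [one_le_div hg]
    nlinarith [mul_nonneg hγ0 hα0.le]
  have hKk : (1 + α + (1 - γ * α) * α) / ((1 - γ * α) * (1 - γ * α)) =
      (1 + α) / (1 - γ * α) * k := by
    rw [hk]
    field_simp
  rw [hKk]
  set K := (1 + α) / (1 - γ * α)
  have hKpos : 0 < K := by linarith
  -- The gain carries `K ^ 2` and the loss only `K`; the spare factor `K ≥ 1` is given away.
  calc β * (K * k) * B ≤ β * (K * k) * B * K := le_mul_of_one_le_right (by positivity) hK1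
    _ = β ^ 2 / 2 * K ^ 2 * (k * 2 / β * B) := by field_simp
    _ < β ^ 2 / 2 * K ^ 2 * (L / A) := by gcongr

end AdamsAD

theorem proposition4p3 (n m : ℕ) (hm : 1 ≤ m) (hmn : m < n) (hdvd : m ∣ n)
    (α γ : ℝ) (hα0 : 0 < α) (hα1 : α < 1) (hγ0 : 0 ≤ γ) (hγ1 : γ < 1 / α - 1) :
    (3 ≤ n / m → ∀ β : ℝ, 0 < β → β ≤ AdamsAD.betaZero n m →
      ENNReal.ofReal
          (β ^ (n / m - 1) / (Nat.factorial (n / m - 1) : ℝ) * ((1 + α) / (1 - γ * α)))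
        < AdamsAD.AD n m β α γ) ∧
    (n / m = 2 →
      ∀ β : ℝ,
        ENNReal.ofReal ((1 + 2 * α - γ * α ^ 2) / (1 + α * (1 - γ) - γ * α ^ 2)) *
            (2 / AdamsAD.gagliardoNirenberg m) < ENNReal.ofReal β →
        β ≤ AdamsAD.betaZero n m →
        ENNReal.ofReal
            (β ^ (n / m - 1) / (Nat.factorial (n / m - 1) : ℝ) * ((1 + α) / (1 - γ * α)))
          < AdamsAD.AD n m β α γ) := by
  obtain ⟨p, rfl⟩ : ∃ p, n = p * m := by
    obtain ⟨p, rfl⟩ := hdvd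
    exact ⟨p, mul_comm m p⟩
  rw [Nat.mul_div_cancel p (by omega)]
  have hγα : γ * α < 1 := by
    have := mul_lt_mul_of_pos_right hγ1 hα0
    rw [sub_mul, one_div_mul_cancel hα0.ne'] at this
    linarith
  refine ⟨fun hp β hβ _ => AdamsAD.lt_AD_of_three_le hm hp hα0 hγ0 hγα hβ, ?_⟩
  rintro rfl β h -
  exact AdamsAD.lt_AD_of_two hm hα0 hγ0 hγα h
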